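/- Let $b\ge 1$ and $\mathbb H=\{0,1\}^b$. Expressions are $\lambda$-terms over string names, $e ::= x \mid \lambda x.\,e \mid e_1\,e_2$, and $|e|$ is the number of nodes of $e$. The randomised hashing algorithm uses the following hash functions and combiners into $\mathbb H$: a hash $f_{\mathrm{name}}(x)$ of names; combiners $f_{\mathrm{SVar}}$, $f_{\mathrm{SLam}}(n,p,s)$, $f_{\mathrm{SApp}}(n,\beta,s_1,s_2)$ for structures; combiners $f_{\mathrm{Here}}$, $f_{\mathrm{Join}}(n,t,p_1,p_2)$ for position trees; $f_{\mathrm{entry}}(h,p)$ for entries of variable maps; and a top-level combiner $f_{\mathrm{sum}}(s,m)$. The arguments other than the name $x$ and the flag $\beta\in\{\mathrm{true},\mathrm{false}\}$ lie in $\mathbb H$, except that $p$ in $f_{\mathrm{SLam}}$ and $p_1$ in $f_{\mathrm{Join}}$ may also be $\bot$ ("absent"). Integers are passed modulo $2^b$. The argument $n$ is the size (number of constructor calls) of the object being built; structures and position trees are represented by their hash code together with their size. $\mathtt{summariseExpr}(e)$ is a pair of a structure and a map $V$ from the free variables of $e$ to position trees. $V$ is stored with a hash code, the XOR of $f_{\mathrm{entry}}(f_{\mathrm{name}}(x),\mathrm{hash}(V(x)))$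 over the entries, which is updated at every operation on the map. * A variable $x$ has structure $f_{\mathrm{SVar}}$ and map $\{x\mapsto f_{\mathrm{Here}}\}$, both of size $1$. * For $\lambda x.\,e$, the entry $p$ of $x$ (or $\bot$ if there is none) is removed from the map of $e$, and the structure is $f_{\mathrm{SLam}}(n,p,s)$ where $s$ is the structure of $e$. * For $e_1\,e_2$, the structure is $f_{\mathrm{SApp}}(n,\beta,s_1,s_2)$, where $\beta$ records whether the map of $e_1$ has more entries than that of $e_2$. If $\beta$ is true, the bigger map is that of $e_1$ and the smaller that of $e_2$; otherwise it is the other way round. The new map is obtained from the bigger map by adding every entry $(x,p)$ of the smaller map to it as $x\mapsto f_{\mathrm{Join}}(n',t,p',p)$, where $p'$ is the value (or $\bot$) of $x$ in the bigger map, $n'$ is the size of the new position tree, and the tag $t$ is the size of the new structure. The hash code of $e$ is $f_{\mathrm{sum}}$ of the hash codes of its structure and of its map. The algorithm puts two subexpressions (nodes) of an expression in the same class if and only if their hash codes are equal. **Theorem.** There is a probability distribution on the choices of all these hash functions and combiners, namely one under which they are random (every value at every argument is uniform on $\mathbb H$, and all these values are independent), such that for every expression $e$, with probability at least $$1-5\,|e|^3\cdot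 2^{-b},$$ the set of classes of subexpressions of $e$ produced by the algorithm is exactly the set of $\alpha$-equivalence classes of the subexpressions of $e$. -/

import Mathlib

open MeasureTheory ProbabilityTheory

namespace AlphaHash

/-! ### Expressions, subexpressions and alpha-equivalence -/

/-- Variable names. -/
abbrev Name := String

/-- Expressions of the lambda calculus with named variables. -/
inductive Expression : Type
  | var (x : Name)
  | lam (x : Name) (body : Expression)
  | app (fn arg : Expression)

namespace Expression

/-- The number of nodes of an expression. -/
def size : Expression → ℕ
  | var _ => 1
  | lam _ a => a.size + 1
  | app a c => a.size + c.size + 1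

/-- All subexpressions of an expression, one list entry for every node (in preorder). -/
def subexprs : Expression → List Expression
  | var x => [var x]
  | lam x a => lam x a :: a.subexprs
  | app a c => app a c :: (a.subexprs ++ c.subexprs)

/-- The occurrences of subexpressions (that is, the nodes) of `e`. -/
abbrev Node (e : Expression) : Type := Fin e.subexprs.length

/-- The subexpression rooted at a node. -/
def at_ (e : Expression) (i : e.Node) : Expression := e.subexprs.get i

/-- `AlphaVar ρ x y`: the variable `x` on the left and the variable `y` on the right have the same
meaning, where `ρ` lists the pairs of corresponding binders that are in scope, innermost first:
either `x` and `y` refer to corresponding binders, or both are free and they are equal. -/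
def AlphaVar : List (Name × Name) → Name → Name → Prop
  | [], x, y => x = y
  | (x', y') :: ρ, x, y => (x = x' ∧ y = y') ∨ (x ≠ x' ∧ y ≠ y' ∧ AlphaVar ρ x y)

/-- Alpha-equivalence below the pairs of corresponding binders listed in `ρ`. -/
def AlphaEqIn : List (Name × Name) → Expression → Expression → Prop
  | ρ, var x, var y => AlphaVar ρ x y
  | ρ, lam x a, lam y c => AlphaEqIn ((x, y) :: ρ) a c
  | ρ, app a₁ a₂, app c₁ c₂ => AlphaEqIn ρ a₁ c₁ ∧ AlphaEqIn ρ a₂ c₂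
  | _, _, _ => False

/-- Alpha-equivalence of expressions: equality up to the names of bound variables. -/
def AlphaEq (a c : Expression) : Prop := AlphaEqIn [] a c

end Expression

/-! ### Hash functions and hash combiners -/

/-- Hash codes are bit strings of length `b`. -/
abbrev HashCode (b : ℕ) := BitVec b

instance instMeasurableSpaceHashCode (b : ℕ) : MeasurableSpace (HashCode b) := ⊤

/-- All possible calls to a hash function or hash combiner. Each constructor is one hash function
or combiner, and its fields are the arguments; a field `size` is the salt, the number of
constructor calls of the object that is being hashed. -/
inductive HashCall (b : ℕ) : Type
  /-- hash of a variable name -/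
  | name (x : Name)
  /-- combiners for the constructors of structures -/
  | sVar
  | sLam (size : HashCode b) (pos : Option (HashCode b)) (body : HashCode b)
  | sApp (size : HashCode b) (leftBigger : Bool) (fn arg : HashCode b)
  /-- combiners for the constructors of position trees -/
  | ptHere
  | ptJoin (size tag : HashCode b) (big : Option (HashCode b)) (small : HashCode b)
  /-- combiner for an entry of a variable map -/
  | entry (name pos : HashCode b)
  /-- top-level combiner for an e-summary -/
  | summary (str vm : HashCode b)

/-- A choice of all the hash functions and hash combiners. -/
abbrev HashFun (b : ℕ) := HashCall b → HashCode b

/-- `P` is the law of a random function from `A` to the finite set `B`: every value is uniform on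
`B`, and the values at distinct arguments are independent. -/
def IsRandomFunction {A B : Type*} [MeasurableSpace B] (P : Measure (A → B)) : Prop :=
  (∀ (a : A) (v : B), P {f | f a = v} = (Nat.card B : ENNReal)⁻¹) ∧
    iIndepFun (fun (a : A) (f : A → B) => f a) P

/-! ### The algorithm, with structures and position trees represented by their hashes -/

/-- A structure is represented by its hash code, together with the number of its constructor calls
(used as salt and as structure tag). -/
structure Structure (b : ℕ) where
  hash : HashCode b
  size : ℕ

/-- A position tree is represented by its hash code, together with the number of its constructor
calls (used as salt). -/
structure PosTree (b : ℕ) where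
  hash : HashCode b
  size : ℕ

section
variable {b : ℕ} (f : HashFun b)

/-- The structure of a variable. -/
def mkSVar : Structure b := ⟨f .sVar, 1⟩

/-- The structure of a lambda, from the positions of the bound variable and the body. -/
def mkSLam (p : Option (PosTree b)) (s : Structure b) : Structure b :=
  let n := s.size + 1
  ⟨f (.sLam (BitVec.ofNat b n) (p.map PosTree.hash) s.hash), n⟩

/-- The structure of an application. -/
def mkSApp (leftBigger : Bool) (s₁ s₂ : Structure b) : Structure b :=
  let n := s₁.size + s₂.size + 1
  ⟨f (.sApp (BitVec.ofNat b n) leftBigger s₁.hash s₂.hash), n⟩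

/-- The tag of a structure: its size, which exceeds the size of all proper sub-structures. -/
def structureTag (s : Structure b) : ℕ := s.size

/-- The position tree of a single occurrence, at the root. -/
def mkPTHere : PosTree b := ⟨f .ptHere, 1⟩

/-- Join of a position tree from the bigger map, if present, and one from the smaller map. -/
def mkPTJoin (tag : ℕ) (big : Option (PosTree b)) (small : PosTree b) : PosTree b :=
  let n := (big.elim 0 PosTree.size) + small.size + 1
  ⟨f (.ptJoin (BitVec.ofNat b n) (BitVec.ofNat b tag) (big.map PosTree.hash) small.hash), n⟩

/-- A variable map: a finite map from names to position trees, stored with its hash. -/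
structure VarMap (b : ℕ) where
  entries : AList (fun _ : Name => PosTree b)
  hash : HashCode b

/-- Hash of an entry of a variable map. -/
def entryHash (key : Name) (pos : PosTree b) : HashCode b :=
  f (.entry (f (.name key)) pos.hash)

/-- The map with a single entry. -/
def singletonVM (key : Name) (pos : PosTree b) : VarMap b :=
  ⟨AList.singleton key pos, entryHash f key pos⟩

/-- Alter the value of a map at a key. -/
def alterVM (g : Option (PosTree b) → PosTree b) (key : Name) (vm : VarMap b) : VarMap b :=
  match vm.entries.lookup key with
  | some old =>
    ⟨vm.entries.insert key (g (some old)),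
      vm.hash ^^^ entryHash f key old ^^^ entryHash f key (g (some old))⟩
  | none =>
    ⟨vm.entries.insert key (g none), vm.hash ^^^ entryHash f key (g none)⟩

/-- Delete a key from a map, and return the value that it had, if any. -/
def removeFromVM (key : Name) (vm : VarMap b) : VarMap b × Option (PosTree b) :=
  match vm.entries.lookup key with
  | some pt => (⟨vm.entries.erase key, vm.hash ^^^ entryHash f key pt⟩, some pt)
  | none => (vm, none)

/-- The number of variables in a map. -/
def sizeVM (vm : VarMap b) : ℕ := vm.entries.entries.length

/-- An e-summary: a structure and a map of the free variables. -/
structure ESummary (b : ℕ) where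
  str : Structure b
  vm : VarMap b

/-- The e-summary of an expression. At an application, the entries of the smaller variable map are
added one by one to the bigger one. -/
def summariseExpr : Expression → ESummary b
  | .var v => ⟨mkSVar f, singletonVM f v (mkPTHere f)⟩
  | .lam x e =>
    let body := summariseExpr e
    let r := removeFromVM f x body.vm
    ⟨mkSLam f r.2 body.str, r.1⟩
  | .app e₁ e₂ =>
    let s₁ := summariseExpr e₁
    let s₂ := summariseExpr e₂
    let leftBigger : Bool := decide (sizeVM s₂.vm < sizeVM s₁.vm)
    let str := mkSApp f leftBigger s₁.str s₂.str
    let tag := structureTag str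
    let big := if leftBigger then s₁.vm else s₂.vm
    let small := if leftBigger then s₂.vm else s₁.vm
    ⟨str, small.entries.entries.foldr
      (fun kv vm => alterVM f (fun mp => mkPTJoin f tag mp kv.2) kv.1 vm) big⟩

/-- The hash code of an e-summary. -/
def hashESummary (s : ESummary b) : HashCode b :=
  f (.summary s.str.hash s.vm.hash)

/-- The set of classes of subexpressions (as sets of nodes) that the algorithm outputs: nodes are
put into the same class when the hash codes of their e-summaries are equal. -/
def recoveredClasses (e : Expression) : Set (Set e.Node) :=
  Set.range fun i : e.Node =>
    {j | hashESummary f (summariseExpr f (e.at_ i)) = hashESummary f (summariseExpr f (e.at_ j))}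

end

/-- The set of alpha-equivalence classes of the subexpressions (as sets of nodes). -/
def alphaClasses (e : Expression) : Set (Set e.Node) :=
  Set.range fun i : e.Node => {j | (e.at_ i).AlphaEq (e.at_ j)}

end AlphaHash

/-! The argument splits into a deterministic statement and a union bound. Hash codes are replaced by
the terms that they encode: `Expression.shape` for the structure and `Expression.positions` for the
map. This symbolic summary is a complete invariant of alpha-equivalence (`alphaEq_iff`). In
particular an application can be undone, because its tag exceeds every tag inside its two sides
(`combine_injective`). The algorithm computes exactly the hash codes of these terms
(`represents_summariseExpr`), so alpha-equivalent nodes always share a hash code and only accidental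
collisions can do harm.

Let n = |e| and ε = 2^(-b). If n ≥ 2^b the bound is trivial; otherwise sizes and tags survive
reduction modulo 2^b. If two different terms have the same hash code, then either their last calls
differ and return the same value, or their last calls agree and some pair of different components
collides. The first event has probability at most ε: thanks to the salt, the last call of the larger
term is not used in computing the arguments of either call, so its value can be resampled freely
(`prob_le_of_update`). Following one differing pair of components per level costs at most nε in all
(`PosTerm.prob_collision`, `StrTerm.prob_collision`). For maps that differ at x, outside events of
probability nε (names) and nε (position trees) some entry call for x occurs just once in the two
XORs, and resampling it costs another ε (`prob_mapHash_collision`). With the top-level combiner a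
pair of nodes fails with probability at most (2n+2)ε, and there are n² pairs.

Probabilities are proportions among functions on a finite set of calls, since one expression
involves only finitely many names; `IsRandomFunction.measure_le_prob` transfers the bounds to the
random function. -/

namespace AlphaHash

/-! ### Uniform choice of the values of a function on a finite set of arguments -/

section Prob
variable {A B : Type*} [Inhabited B]

/-- The functions that take the default value outside `S`. -/
def supportedOn (S : Set A) : Set (A → B) := {f | ∀ a ∉ S, f a = default}

open Classical in
/-- Functions with default value outside `S` are the functions on `S`. -/
noncomputable def supportedOnEquiv (S : Set A) : (supportedOn S : Set (A → B)) ≃ (S → B) where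
  toFun f s := f.1 s
  invFun g := ⟨fun a => if h : a ∈ S then g ⟨a, h⟩ else default, fun a ha => by simp [ha]⟩
  left_inv f := by
    ext a
    by_cases h : a ∈ S
    · simp [h]
    · simp [h, f.2 a h]
  right_inv g := by
    ext a
    simp

/-- The proportion of the functions supported on `S` that belong to `E`. -/
noncomputable def prob (S : Set A) (E : Set (A → B)) : ℝ :=
  (E ∩ supportedOn S).ncard / (supportedOn S : Set (A → B)).ncard

variable {S : Set A}

theorem ncard_supportedOn (hS : S.Finite) :
    (supportedOn S : Set (A → B)).ncard = Nat.card B ^ S.ncard := by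
  have := hS.to_subtype
  rw [← Nat.card_coe_set_eq, Nat.card_congr (supportedOnEquiv (B := B) S), Nat.card_fun,
    Nat.card_coe_set_eq]

theorem prob_empty (S : Set A) : prob S (∅ : Set (A → B)) = 0 := by
  simp [prob]

theorem prob_union_le (S : Set A) (E F : Set (A → B)) :
    prob S (E ∪ F) ≤ prob S E + prob S F := by
  unfold prob
  rw [← add_div, Set.union_inter_distrib_right]
  gcongr
  exact_mod_cast Set.ncard_union_le _ _

theorem prob_biUnion_le {ι : Type*} (S : Set A) (t : Finset ι) (E : ι → Set (A → B)) :
    prob S (⋃ i ∈ t, E i) ≤ ∑ i ∈ t, prob S (E i) := by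
  classical
  induction t using Finset.induction_on with
  | empty => simp [prob_empty]
  | insert i t hi ih =>
    rw [Finset.set_biUnion_insert, Finset.sum_insert hi]
    exact (prob_union_le _ _ _).trans (by gcongr)

variable [Finite B]

theorem finite_supportedOn (hS : S.Finite) : (supportedOn S : Set (A → B)).Finite := by
  have := hS.to_subtype
  exact Set.finite_coe_iff.1 (Finite.of_equiv _ (supportedOnEquiv (B := B) S).symm)

theorem ncard_supportedOn_pos (hS : S.Finite) :
    (0 : ℝ) < (supportedOn S : Set (A → B)).ncard := by
  rw [ncard_supportedOn hS]
  have : 0 < Nat.card B := Nat.card_pos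
  positivity

theorem prob_mono (hS : S.Finite) {E F : Set (A → B)} (h : E ⊆ F) : prob S E ≤ prob S F := by
  unfold prob
  gcongr
  exact (finite_supportedOn hS).subset Set.inter_subset_right

theorem prob_le_add (hS : S.Finite) {E F G : Set (A → B)} (h : E ⊆ F ∪ G) {x y : ℝ}
    (hF : prob S F ≤ x) (hG : prob S G ≤ y) : prob S E ≤ x + y :=
  (prob_mono hS h).trans ((prob_union_le S F G).trans (add_le_add hF hG))

open Classical in
/-- If resampling the value at `a f` changes neither `a f` nor `g f`, then `f (a f) = g f` has
at most the probability of a single value. -/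
theorem prob_le_of_update (hS : S.Finite) (E : Set (A → B)) (a : (A → B) → A) (g : (A → B) → B)
    (ha : ∀ f ∈ E, a f ∈ S) (hE : ∀ f ∈ E, f (a f) = g f)
    (ha' : ∀ f ∈ E, ∀ v, a (Function.update f (a f) v) = a f)
    (hg : ∀ f ∈ E, ∀ v, g (Function.update f (a f) v) = g f) :
    prob S E ≤ (Nat.card B : ℝ)⁻¹ := by
  have hB : (0 : ℝ) < Nat.card B := by exact_mod_cast Nat.card_pos
  -- Resampling maps pairs (f, v) injectively to functions: the updated function still determines `a
  -- f` and `g f`, its value at `a f` is v, and the lost value of f there was `g f`.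
  have key : (E ∩ supportedOn S).ncard * Nat.card B ≤ (supportedOn S : Set (A → B)).ncard := by
    rw [← Set.ncard_univ, ← Set.ncard_prod]
    refine Set.ncard_le_ncard_of_injOn (fun x => Function.update x.1 (a x.1) x.2) ?_ ?_
      (finite_supportedOn hS)
    · rintro ⟨f, v⟩ ⟨⟨hf, hfS⟩, -⟩ c hc
      have : c ≠ a f := fun h => hc (h ▸ ha f hf)
      simp only [Function.update_of_ne this]
      exact hfS c hc
    · rintro ⟨f, v⟩ ⟨⟨hf, -⟩, -⟩ ⟨f', v'⟩ ⟨⟨hf', -⟩, -⟩ h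
      simp only at h hf hf'
      have e1 : a f = a f' := by rw [← ha' f hf v, h, ha' f' hf' v']
      have e2 : g f = g f' := by rw [← hg f hf v, h, hg f' hf' v']
      have e3 : v = v' := by
        have := congrFun h (a f)
        rw [Function.update_self, e1, Function.update_self] at this
        exact this
      have e4 : f = f' := by
        funext c
        by_cases hc : c = a f
        · rw [hc, hE f hf, e1, hE f' hf', e2]
        · have := congrFun h c
          rwa [Function.update_of_ne hc, Function.update_of_ne (e1 ▸ hc)] at this
      rw [e3, e4]
  unfold prob
  rw [div_le_iff₀ (ncard_supportedOn_pos hS), inv_mul_eq_div, le_div_iff₀ hB]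
  exact_mod_cast key

open Classical in
/-- Values at two different arguments collide with at most the probability of a single value, also
when the arguments are random but do not change when the value at the first one is resampled. -/
theorem prob_collision_le (hS : S.Finite) (a a' : (A → B) → A) (ha : ∀ f, a f ∈ S)
    (h : ∀ f v, a (Function.update f (a f) v) = a f)
    (h' : ∀ f v, a' (Function.update f (a f) v) = a' f) :
    prob S {f | a f ≠ a' f ∧ f (a f) = f (a' f)} ≤ (Nat.card B : ℝ)⁻¹ := by
  refine prob_le_of_update hS _ a (fun f => f (a' f)) (fun f _ => ha f) (fun f hf => hf.2)
    (fun f _ => h f) (fun f hf v => ?_)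
  simp only [h', Function.update_of_ne (Ne.symm hf.1)]

/-- An event that depends only on the values on `S` has the same probability for a random function
as for a uniform function on `S`. -/
theorem IsRandomFunction.measure_le_prob [MeasurableSpace B] [MeasurableSingletonClass B]
    {P : Measure (A → B)} (hP : IsRandomFunction P) (hS : S.Finite) {E : Set (A → B)}
    (hE : ∀ f ∈ E, ∀ g, (∀ a ∈ S, g a = f a) → g ∈ E) : P.real E ≤ prob S E := by
  classical
  have hfin : (E ∩ supportedOn S).Finite := (finite_supportedOn hS).subset Set.inter_subset_right
  have cyl (g : A → B) : P.real {f | ∀ a ∈ S, f a = g a} = ((Nat.card B : ℝ) ^ S.ncard)⁻¹ := by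
    have h1 : {f : A → B | ∀ a ∈ S, f a = g a} =
        ⋂ a ∈ hS.toFinset, (fun f : A → B => f a) ⁻¹' {g a} := by
      ext f
      simp
    rw [measureReal_def, h1, hP.2.measure_inter_preimage_eq_mul hS.toFinset
      (fun a _ => measurableSet_singleton (g a))]
    have h2 (a : A) : P ((fun f : A → B => f a) ⁻¹' {g a}) = (Nat.card B : ENNReal)⁻¹ :=
      hP.1 a (g a)
    simp only [h2, Finset.prod_const, ENNReal.toReal_pow, ENNReal.toReal_inv,
      ENNReal.toReal_natCast, inv_pow, Set.ncard_eq_toFinset_card S hS]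
  -- `E` is covered by the cylinders around its members that vanish to the default outside `S`. Only
  -- this finite cover is measured, so `E` itself need not be measurable.
  have hsub : E ⊆ ⋃ g ∈ hfin.toFinset, {f | ∀ a ∈ S, f a = g a} := by
    intro f hf
    simp only [Set.mem_iUnion]
    refine ⟨fun a => if a ∈ S then f a else default, ?_, ?_⟩
    · rw [Set.Finite.mem_toFinset]
      exact ⟨hE f hf _ fun a ha => by simp [ha], fun a ha => by simp [ha]⟩
    · intro a ha
      simp [ha]
  have hP1 : IsProbabilityMeasure P := hP.2.isProbabilityMeasure
  calc P.real E ≤ P.real (⋃ g ∈ hfin.toFinset, {f | ∀ a ∈ S, f a = g a}) :=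
        measureReal_mono hsub (measure_ne_top P _)
    _ ≤ ∑ g ∈ hfin.toFinset, P.real {f | ∀ a ∈ S, f a = g a} :=
        measureReal_biUnion_finset_le _ _
    _ = prob S E := by
        simp only [cyl, Finset.sum_const, nsmul_eq_mul, prob, ncard_supportedOn hS,
          Nat.cast_pow, Set.ncard_eq_toFinset_card _ hfin, div_eq_mul_inv]

end Prob

/-! ### Existence of a random function -/

theorem exists_isRandomFunction (A B : Type*) [Fintype B] [Nonempty B] [MeasurableSpace B]
    [MeasurableSingletonClass B] :
    ∃ P : Measure (A → B), IsProbabilityMeasure P ∧ IsRandomFunction P := by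
  let μ : Measure B := uniformOn Set.univ
  have : IsProbabilityMeasure μ := isProbabilityMeasure_uniformOn Set.finite_univ Set.univ_nonempty
  refine ⟨Measure.infinitePi fun _ : A => μ, inferInstance, fun a v => ?_, ?_⟩
  · have h1 : {f : A → B | f a = v} = (fun f => f a) ⁻¹' {v} := rfl
    rw [h1, ← Measure.map_apply (measurable_pi_apply a) (measurableSet_singleton v)]
    have h2 := (measurePreserving_eval_infinitePi (fun _ : A => μ) a).map_eq
    rw [show (fun f : A → B => f a) = Function.eval a from rfl, h2]
    simp [μ, uniformOn_univ, Nat.card_eq_fintype_card]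
  · exact iIndepFun_infinitePi (X := fun _ (x : B) => x) (fun _ => measurable_id)

/-! ### Symbolic structures and position trees -/

/-- Symbolic position trees. -/
inductive PosTerm : Type
  | here
  | extend (tag : ℕ) (small : PosTerm)
  | join (tag : ℕ) (big small : PosTerm)

/-- Symbolic structures. -/
inductive StrTerm : Type
  | var
  | lam (pos : Option PosTerm) (body : StrTerm)
  | app (leftBigger : Bool) (fn arg : StrTerm)

namespace PosTerm

/-- The number of constructor calls of a position tree. -/
def size : PosTerm → ℕ
  | here => 1
  | extend _ p => p.size + 1
  | join _ q p => q.size + p.size + 1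

/-- All tags in a position tree are at most `n`. -/
def TagsLE (n : ℕ) : PosTerm → Prop
  | here => True
  | extend t p => t ≤ n ∧ p.TagsLE n
  | join t q p => t ≤ n ∧ q.TagsLE n ∧ p.TagsLE n

theorem TagsLE.mono {m n : ℕ} (h : m ≤ n) {p : PosTerm} (hp : p.TagsLE m) : p.TagsLE n := by
  induction p with
  | here => trivial
  | extend t p ih => exact ⟨hp.1.trans h, ih hp.2⟩
  | join t q p ihq ihp => exact ⟨hp.1.trans h, ihq hp.2.1, ihp hp.2.2⟩

/-- The position of a variable in an application, from its positions on the two sides. -/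
def combine (t : ℕ) (big small : Option PosTerm) : Option PosTerm :=
  small.elim big fun p => some (big.elim (extend t p) fun q => join t q p)

theorem combine_ne_none {t : ℕ} {big small : Option PosTerm} :
    combine t big small ≠ none ↔ big ≠ none ∨ small ≠ none := by
  cases big <;> cases small <;> simp [combine]

/-- A root with tag t cannot come from the bigger side, whose tags are at most m < t. The root
therefore reveals whether the smaller side contributed, and its constructor whether the bigger side
did. -/
theorem combine_injective {m t : ℕ} (hm : m < t) {q q' p p' : Option PosTerm}
    (hq : ∀ r ∈ q, r.TagsLE m) (hq' : ∀ r ∈ q', r.TagsLE m)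
    (h : combine t q p = combine t q' p') : q = q' ∧ p = p' := by
  have aux1 (r : PosTerm) : ¬ (extend t r).TagsLE m := fun h => hm.not_ge h.1
  have aux2 (r s : PosTerm) : ¬ (join t r s).TagsLE m := fun h => hm.not_ge h.1
  cases q <;> cases p <;> cases q' <;> cases p' <;> simp_all [combine] <;> subst_vars <;> grind

end PosTerm

/-- The number of constructor calls of a structure, not counting those of position trees. -/
def StrTerm.size : StrTerm → ℕ
  | var => 1
  | lam _ s => s.size + 1
  | app _ s₁ s₂ => s₁.size + s₂.size + 1

/-- The position trees in a structure have at most the size of the body in which they occur. -/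
def StrTerm.WellSized : StrTerm → Prop
  | var => True
  | lam p s => (∀ q ∈ p, q.size ≤ s.size ∧ q.TagsLE s.size) ∧ s.WellSized
  | app _ s₁ s₂ => s₁.WellSized ∧ s₂.WellSized

/-! ### Free variables and symbolic summaries of expressions -/

namespace Expression

/-- The free variables. -/
def fv : Expression → Finset Name
  | var x => {x}
  | lam x a => a.fv.erase x
  | app a c => a.fv ∪ c.fv

/-- The names of the variables that occur. -/
def vars : Expression → Finset Name
  | var x => {x}
  | lam _ a => a.vars
  | app a c => a.vars ∪ c.vars

open PosTerm in
/-- The position trees of the free variables. -/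
def positions : Expression → Name → Option PosTerm
  | var x => fun y => if y = x then some here else none
  | lam x a => fun y => if y = x then none else a.positions y
  | app a c => fun y =>
    if c.fv.card < a.fv.card then combine (a.size + c.size + 1) (a.positions y) (c.positions y)
    else combine (a.size + c.size + 1) (c.positions y) (a.positions y)

/-- The symbolic structure. -/
def shape : Expression → StrTerm
  | var _ => .var
  | lam x a => .lam (a.positions x) a.shape
  | app a c => .app (decide (c.fv.card < a.fv.card)) a.shape c.shape

theorem size_pos (a : Expression) : 0 < a.size := by
  cases a <;> simp [size]

theorem size_shape (a : Expression) : a.shape.size = a.size := by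
  induction a <;> simp_all [shape, StrTerm.size, size]

theorem fv_subset_vars (a : Expression) : a.fv ⊆ a.vars := by
  induction a with
  | var x => simp [fv, vars]
  | lam x a ih => exact (Finset.erase_subset _ _).trans ih
  | app a c iha ihc => exact Finset.union_subset_union iha ihc

theorem card_vars_le (a : Expression) : a.vars.card ≤ a.size := by
  induction a with
  | var x => simp [vars, size]
  | lam x a ih => simp only [vars, size]; omega
  | app a c iha ihc =>
    have := Finset.card_union_le a.vars c.vars
    simp only [vars, size]
    omega

theorem mem_fv (a : Expression) (y : Name) : y ∈ a.fv ↔ a.positions y ≠ none := by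
  induction a with
  | var x => simp [fv, positions]
  | lam x a ih => simp [fv, positions, ih]
  | app a c iha ihc =>
    simp only [fv, positions, Finset.mem_union, iha, ihc]
    split_ifs
    · rw [PosTerm.combine_ne_none]
    · rw [PosTerm.combine_ne_none, or_comm]

theorem size_combine_le {m n t : ℕ} {q p : Option PosTerm}
    (hq : ∀ r ∈ q, r.size ≤ m) (hp : ∀ r ∈ p, r.size ≤ n) :
    ∀ r ∈ PosTerm.combine t q p, r.size ≤ m + n + 1 := by
  cases q <;> cases p <;> simp_all [PosTerm.combine, PosTerm.size] <;> omega

theorem tagsLE_combine {m t : ℕ} (ht : t ≤ m) {q p : Option PosTerm}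
    (hq : ∀ r ∈ q, r.TagsLE m) (hp : ∀ r ∈ p, r.TagsLE m) :
    ∀ r ∈ PosTerm.combine t q p, r.TagsLE m := by
  cases q <;> cases p <;> simp_all [PosTerm.combine, PosTerm.TagsLE]

theorem size_positions_le (a : Expression) (y : Name) : ∀ p ∈ a.positions y, p.size ≤ a.size := by
  induction a with
  | var x => simp only [positions]; split_ifs <;> simp [PosTerm.size, size]
  | lam x a ih =>
    simp only [positions, size]
    split_ifs
    · simp
    · exact fun p hp => (ih p hp).trans (Nat.le_succ _)
  | app a c iha ihc =>
    simp only [positions, size]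
    split_ifs
    · exact size_combine_le iha ihc
    · rw [Nat.add_comm a.size]
      exact size_combine_le ihc iha

theorem tagsLE_positions (a : Expression) (y : Name) : ∀ p ∈ a.positions y, p.TagsLE a.size := by
  induction a with
  | var x => simp only [positions]; split_ifs <;> simp [PosTerm.TagsLE]
  | lam x a ih =>
    simp only [positions, size]
    split_ifs
    · simp
    · exact fun p hp => (ih p hp).mono (Nat.le_succ _)
  | app a c iha ihc =>
    have ha := fun p hp => (iha p hp).mono (show a.size ≤ a.size + c.size + 1 by omega)
    have hc := fun p hp => (ihc p hp).mono (show c.size ≤ a.size + c.size + 1 by omega)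
    simp only [positions, size]
    split_ifs
    · exact tagsLE_combine le_rfl ha hc
    · exact tagsLE_combine le_rfl hc ha

theorem wellSized_shape (a : Expression) : a.shape.WellSized := by
  induction a with
  | var x => trivial
  | lam x a ih =>
    refine ⟨fun q hq => ?_, ih⟩
    rw [size_shape]
    exact ⟨size_positions_le a x q hq, tagsLE_positions a x q hq⟩
  | app a c iha ihc => exact ⟨iha, ihc⟩

/-! ### Alpha-equivalence is equality of symbolic summaries -/

/-- Since both names must avoid the inner binders before an outer pair is consulted, `ρ` acts as a
partial bijection between names. -/
theorem AlphaVar.eq_iff {ρ : List (Name × Name)} {x y x' y' : Name} (h : AlphaVar ρ x y)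
    (h' : AlphaVar ρ x' y') : x = x' ↔ y = y' := by
  induction ρ with
  | nil =>
    simp only [AlphaVar] at h h'
    rw [h, h']
  | cons r ρ ih =>
    obtain ⟨u, v⟩ := r
    simp only [AlphaVar] at h h'
    grind

/-- The symbolic summaries agree up to the correspondence of variables given by `ρ`. -/
structure SameSummary (ρ : List (Name × Name)) (a c : Expression) : Prop where
  shape : a.shape = c.shape
  left : ∀ x ∈ a.fv, ∃ y, AlphaVar ρ x y
  right : ∀ y ∈ c.fv, ∃ x, AlphaVar ρ x y
  positions : ∀ x y, AlphaVar ρ x y → a.positions x = c.positions y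

theorem SameSummary.mem_fv {ρ : List (Name × Name)} {a c : Expression} (h : SameSummary ρ a c)
    {x y : Name} (hxy : AlphaVar ρ x y) : x ∈ a.fv ↔ y ∈ c.fv := by
  rw [Expression.mem_fv, Expression.mem_fv, h.positions x y hxy]

/-- The correspondence `ρ` restricts to a bijection of the free variables. Hence both applications
in a comparison choose the same side as the bigger one. -/
theorem SameSummary.card_fv {ρ : List (Name × Name)} {a c : Expression} (h : SameSummary ρ a c) :
    a.fv.card = c.fv.card := by
  choose! φ hφ using h.left
  refine Finset.card_bij (fun x _ => φ x) (fun x hx => (h.mem_fv (hφ x hx)).1 hx)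
    (fun x hx x' hx' e => (AlphaVar.eq_iff (hφ x hx) (hφ x' hx')).2 e) (fun y hy => ?_)
  obtain ⟨x, hxy⟩ := h.right y hy
  have hx := (h.mem_fv hxy).2 hy
  exact ⟨x, hx, (AlphaVar.eq_iff (hφ x hx) hxy).1 rfl⟩

theorem sameSummary_var {ρ : List (Name × Name)} {x y : Name} :
    SameSummary ρ (var x) (var y) ↔ AlphaVar ρ x y := by
  constructor
  · intro h
    obtain ⟨z, hz⟩ := h.left x (by simp [fv])
    have := (h.mem_fv hz).1 (by simp [fv])
    simp only [fv, Finset.mem_singleton] at this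
    exact this ▸ hz
  · intro h
    refine ⟨rfl, ?_, ?_, fun u v huv => ?_⟩
    · simpa [fv] using ⟨y, h⟩
    · simpa [fv] using ⟨x, h⟩
    · simp only [Expression.positions, AlphaVar.eq_iff huv h]

/-- The position tree stored at the binder accounts for the new pair (x, y); all other free
variables keep their partners under `ρ`. The conditions `left` and `right` exclude free variables
that lose their partner by shadowing. -/
theorem sameSummary_lam {ρ : List (Name × Name)} {x y : Name} {a c : Expression} :
    SameSummary ρ (lam x a) (lam y c) ↔ SameSummary ((x, y) :: ρ) a c := by
  constructor
  · intro h
    have hs := h.shape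
    simp only [Expression.shape, StrTerm.lam.injEq] at hs
    refine ⟨hs.2, fun z hz => ?_, fun w hw => ?_, fun z w hzw => ?_⟩
    · by_cases hzx : z = x
      · exact ⟨y, Or.inl ⟨hzx, rfl⟩⟩
      · have hz' : z ∈ (lam x a).fv := by simp [fv, hz, hzx]
        obtain ⟨w, hw⟩ := h.left z hz'
        have := (h.mem_fv hw).1 hz'
        simp only [fv, Finset.mem_erase] at this
        exact ⟨w, Or.inr ⟨hzx, this.1, hw⟩⟩
    · by_cases hwy : w = y
      · exact ⟨x, Or.inl ⟨rfl, hwy⟩⟩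
      · have hw' : w ∈ (lam y c).fv := by simp [fv, hw, hwy]
        obtain ⟨z, hz⟩ := h.right w hw'
        have := (h.mem_fv hz).2 hw'
        simp only [fv, Finset.mem_erase] at this
        exact ⟨z, Or.inr ⟨this.1, hwy, hz⟩⟩
    · rcases hzw with ⟨rfl, rfl⟩ | ⟨hz, hw, hzw⟩
      · exact hs.1
      · simpa [Expression.positions, hz, hw] using h.positions z w hzw
  · intro h
    refine ⟨?_, fun z hz => ?_, fun w hw => ?_, fun z w hzw => ?_⟩
    · simp only [Expression.shape, h.shape, h.positions x y (Or.inl ⟨rfl, rfl⟩)]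
    · simp only [fv, Finset.mem_erase] at hz
      obtain ⟨w, hw⟩ := h.left z hz.2
      rcases hw with hw | hw
      · exact absurd hw.1 hz.1
      · exact ⟨w, hw.2.2⟩
    · simp only [fv, Finset.mem_erase] at hw
      obtain ⟨z, hz⟩ := h.right w hw.2
      rcases hz with hz | hz
      · exact absurd hz.2 hw.1
      · exact ⟨z, hz.2.2⟩
    · simp only [Expression.positions]
      by_cases hz : z = x <;> by_cases hw : w = y
      · simp [hz, hw]
      -- Here z is shadowed by x while w is not shadowed by y. If w were free in c, its partner
      -- under the extended list would avoid x, but by uniqueness it is z = x.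
      · simp only [hz, hw, if_true, if_false]
        by_contra hne
        obtain ⟨u, hu⟩ := h.right w ((Expression.mem_fv c w).2 (Ne.symm hne))
        rcases hu with hu | hu
        · exact hw hu.2
        · exact hu.1 (((AlphaVar.eq_iff hu.2.2 hzw).2 rfl).trans hz)
      · simp only [hz, hw, if_true, if_false]
        by_contra hne
        obtain ⟨u, hu⟩ := h.left z ((Expression.mem_fv a z).2 hne)
        rcases hu with hu | hu
        · exact hz hu.1
        · exact hu.2.1 (((AlphaVar.eq_iff hu.2.2 hzw).1 rfl).trans hw)
      · simpa [hz, hw] using h.positions z w (Or.inr ⟨hz, hw, hzw⟩)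

/-- Equal shapes give equal sizes and flags, so on both sides the maps were combined in the same
direction and with the same tag, and `combine_injective` separates them again. -/
theorem sameSummary_app {ρ : List (Name × Name)} {a₁ a₂ c₁ c₂ : Expression} :
    SameSummary ρ (app a₁ a₂) (app c₁ c₂) ↔ SameSummary ρ a₁ c₁ ∧ SameSummary ρ a₂ c₂ := by
  constructor
  · intro h
    have hs := h.shape
    simp only [Expression.shape, StrTerm.app.injEq, decide_eq_decide] at hs
    obtain ⟨hβ, hs₁, hs₂⟩ := hs
    have e₁ : a₁.size = c₁.size := by rw [← size_shape, hs₁, size_shape]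
    have e₂ : a₂.size = c₂.size := by rw [← size_shape, hs₂, size_shape]
    have key : ∀ x y, AlphaVar ρ x y →
        a₁.positions x = c₁.positions y ∧ a₂.positions x = c₂.positions y := by
      intro x y hxy
      have hp := h.positions x y hxy
      have ta₁ := tagsLE_positions a₁ x
      have ta₂ := tagsLE_positions a₂ x
      have tc₁ := tagsLE_positions c₁ y
      have tc₂ := tagsLE_positions c₂ y
      simp only [Expression.positions, hβ] at hp
      rw [e₁] at hp ta₁
      rw [e₂] at hp ta₂
      split_ifs at hp
      · exact PosTerm.combine_injective (by omega) ta₁ tc₁ hp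
      · exact (PosTerm.combine_injective (by omega) ta₂ tc₂ hp).symm
    refine ⟨⟨hs₁, fun x hx => h.left x ?_, fun y hy => h.right y ?_, fun x y h => (key x y h).1⟩,
      ⟨hs₂, fun x hx => h.left x ?_, fun y hy => h.right y ?_, fun x y h => (key x y h).2⟩⟩ <;>
    simp [fv, *]
  · rintro ⟨h₁, h₂⟩
    have e₁ : a₁.size = c₁.size := by rw [← size_shape, h₁.shape, size_shape]
    have e₂ : a₂.size = c₂.size := by rw [← size_shape, h₂.shape, size_shape]
    refine ⟨?_, fun x hx => ?_, fun y hy => ?_, fun x y hxy => ?_⟩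
    · simp only [Expression.shape, h₁.shape, h₂.shape, h₁.card_fv, h₂.card_fv]
    · exact (Finset.mem_union.1 hx).elim (h₁.left x) (h₂.left x)
    · exact (Finset.mem_union.1 hy).elim (h₁.right y) (h₂.right y)
    · simp only [Expression.positions, h₁.card_fv, h₂.card_fv, e₁, e₂, h₁.positions x y hxy,
        h₂.positions x y hxy]

theorem alphaEqIn_iff (a c : Expression) (ρ : List (Name × Name)) :
    AlphaEqIn ρ a c ↔ SameSummary ρ a c := by
  induction a generalizing c ρ with
  | var x =>
    cases c with
    | var y => rw [sameSummary_var, AlphaEqIn]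
    | lam y c => exact iff_of_false id fun h => nomatch h.shape
    | app c d => exact iff_of_false id fun h => nomatch h.shape
  | lam x a ih =>
    cases c with
    | var y => exact iff_of_false id fun h => nomatch h.shape
    | lam y c => rw [sameSummary_lam, AlphaEqIn, ih]
    | app c d => exact iff_of_false id fun h => nomatch h.shape
  | app a₁ a₂ ih₁ ih₂ =>
    cases c with
    | var y => exact iff_of_false id fun h => nomatch h.shape
    | lam y c => exact iff_of_false id fun h => nomatch h.shape
    | app c d => rw [sameSummary_app, AlphaEqIn, ih₁, ih₂]

/-- Two expressions are alpha-equivalent if and only if they have the same symbolic summary. -/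
theorem alphaEq_iff (a c : Expression) :
    a.AlphaEq c ↔ a.shape = c.shape ∧ a.positions = c.positions := by
  rw [AlphaEq, alphaEqIn_iff]
  constructor
  · exact fun h => ⟨h.shape, funext fun x => h.positions x x rfl⟩
  · rintro ⟨h₁, h₂⟩
    refine ⟨h₁, fun x _ => ⟨x, rfl⟩, fun x _ => ⟨x, rfl⟩, ?_⟩
    rintro x y rfl
    rw [h₂]

/-! ### Subexpressions -/

theorem length_subexprs (e : Expression) : e.subexprs.length = e.size := by
  induction e with
  | var x => rfl
  | lam x a ih => simp [subexprs, size, ih]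
  | app a c iha ihc => simp [subexprs, size, iha, ihc]

theorem size_le_of_mem_subexprs {a e : Expression} (h : a ∈ e.subexprs) : a.size ≤ e.size := by
  induction e with
  | var x => simp_all [subexprs]
  | lam x c ih =>
    rcases List.mem_cons.1 h with rfl | h
    · rfl
    · exact (ih h).trans (by simp [size])
  | app c d ihc ihd =>
    rcases List.mem_cons.1 h with rfl | h
    · rfl
    · rcases List.mem_append.1 h with h | h
      · exact (ihc h).trans (by simp only [size]; omega)
      · exact (ihd h).trans (by simp only [size]; omega)

theorem vars_subset_of_mem_subexprs {a e : Expression} (h : a ∈ e.subexprs) : a.vars ⊆ e.vars := by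
  induction e with
  | var x => simp_all [subexprs]
  | lam x c ih =>
    rcases List.mem_cons.1 h with rfl | h
    · rfl
    · exact ih h
  | app c d ihc ihd =>
    rcases List.mem_cons.1 h with rfl | h
    · rfl
    · rcases List.mem_append.1 h with h | h
      · exact (ihc h).trans Finset.subset_union_left
      · exact (ihd h).trans Finset.subset_union_right

end Expression

/-! ### Hash codes of symbolic objects -/

section Eval
variable {b : ℕ} (f : HashFun b)

/-- The hash code of a symbolic position tree. -/
def PosTerm.hash : PosTerm → HashCode b
  | here => f .ptHere
  | extend t p => f (.ptJoin (BitVec.ofNat b (p.size + 1)) (BitVec.ofNat b t) none p.hash)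
  | join t q p =>
    f (.ptJoin (BitVec.ofNat b (q.size + p.size + 1)) (BitVec.ofNat b t) (some q.hash) p.hash)

/-- The hash call that produces the hash code of a position tree. -/
def PosTerm.call : PosTerm → HashCall b
  | here => .ptHere
  | extend t p => .ptJoin (BitVec.ofNat b (p.size + 1)) (BitVec.ofNat b t) none (p.hash f)
  | join t q p =>
    .ptJoin (BitVec.ofNat b (q.size + p.size + 1)) (BitVec.ofNat b t) (some (q.hash f)) (p.hash f)

theorem PosTerm.hash_eq (p : PosTerm) : p.hash f = f (p.call f) := by
  cases p <;> rfl

/-- The position tree of a symbolic position tree. -/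
def PosTerm.eval (p : PosTerm) : PosTree b := ⟨p.hash f, p.size⟩

/-- The hash code of a symbolic structure. -/
def StrTerm.hash : StrTerm → HashCode b
  | var => f .sVar
  | lam p s => f (.sLam (BitVec.ofNat b (s.size + 1)) (p.map (PosTerm.hash f)) s.hash)
  | app β s₁ s₂ => f (.sApp (BitVec.ofNat b (s₁.size + s₂.size + 1)) β s₁.hash s₂.hash)

/-- The hash call that produces the hash code of a structure. -/
def StrTerm.call : StrTerm → HashCall b
  | var => .sVar
  | lam p s => .sLam (BitVec.ofNat b (s.size + 1)) (p.map (PosTerm.hash f)) (s.hash f)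
  | app β s₁ s₂ => .sApp (BitVec.ofNat b (s₁.size + s₂.size + 1)) β (s₁.hash f) (s₂.hash f)

theorem StrTerm.hash_eq (s : StrTerm) : s.hash f = f (s.call f) := by
  cases s <;> rfl

/-- The contribution of a variable to the hash code of a map. -/
def entryTerm (V : Name → Option PosTerm) (y : Name) : HashCode b :=
  (V y).elim 0 fun p => f (.entry (f (.name y)) (p.hash f))

/-- The hash code of a symbolic map with the domain `F`. -/
def mapHash (F : Finset Name) (V : Name → Option PosTerm) : HashCode b :=
  F.fold (· ^^^ ·) 0 (entryTerm f V)

theorem mapHash_congr {F : Finset Name} {V W : Name → Option PosTerm} (h : ∀ y ∈ F, V y = W y) :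
    mapHash f F V = mapHash f F W :=
  Finset.fold_congr fun y hy => by rw [entryTerm, entryTerm, h y hy]

theorem mapHash_insert {F : Finset Name} {V : Name → Option PosTerm} {x : Name} (hx : x ∉ F) :
    mapHash f (insert x F) V = entryTerm f V x ^^^ mapHash f F V :=
  Finset.fold_insert hx

theorem mapHash_erase {F : Finset Name} {V : Name → Option PosTerm} {x : Name} (hx : x ∈ F) :
    mapHash f F V = entryTerm f V x ^^^ mapHash f (F.erase x) V := by
  rw [← mapHash_insert f (Finset.notMem_erase x F), Finset.insert_erase hx]

/-- Absent names contribute 0 to the XOR. This allows two maps to be compared over one common set of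
names. -/
theorem mapHash_subset {F G : Finset Name} {V : Name → Option PosTerm} (h : F ⊆ G)
    (hV : ∀ y ∈ G, y ∉ F → V y = none) : mapHash f G V = mapHash f F V := by
  induction G using Finset.strongInduction with
  | H G ih =>
    by_cases hG : G ⊆ F
    · rw [Finset.Subset.antisymm hG h]
    · obtain ⟨x, hxG, hxF⟩ := Finset.not_subset.1 hG
      rw [mapHash_erase f hxG, ih _ (Finset.erase_ssubset hxG)
        (fun y hy => Finset.mem_erase.2 ⟨fun e => hxF (e ▸ hy), h hy⟩)
        (fun y hy => hV y (Finset.mem_of_mem_erase hy)), entryTerm, hV x hxG hxF]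
      simp

/-- A variable map computed by the algorithm stores the position trees `V` with domain `F`. -/
structure VarMap.Represents (vm : VarMap b) (F : Finset Name) (V : Name → Option PosTerm) :
    Prop where
  lookup : ∀ y, vm.entries.lookup y = (V y).map (PosTerm.eval f)
  mem : ∀ y, y ∈ F ↔ V y ≠ none
  hash : vm.hash = mapHash f F V

/-! ### Correctness of the map operations -/

variable {f}

theorem VarMap.Represents.keys {vm : VarMap b} {F : Finset Name} {V : Name → Option PosTerm}
    (h : vm.Represents f F V) : vm.entries.keys.toFinset = F := by
  ext y
  rw [List.mem_toFinset, ← AList.mem_keys, ← AList.lookup_isSome, h.lookup, h.mem]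
  cases V y <;> simp

theorem VarMap.Represents.sizeVM {vm : VarMap b} {F : Finset Name} {V : Name → Option PosTerm}
    (h : vm.Represents f F V) : sizeVM vm = F.card := by
  rw [← h.keys, List.toFinset_card_of_nodup vm.entries.keys_nodup, AList.keys, List.keys,
    List.length_map, AlphaHash.sizeVM]

theorem VarMap.represents_singleton (x : Name) :
    (singletonVM f x (mkPTHere f)).Represents f {x} (Expression.positions (.var x)) := by
  refine ⟨fun y => ?_, fun y => by simp [Expression.positions], ?_⟩
  · by_cases h : y = x
    · subst h
      simp [singletonVM, Expression.positions, AList.lookup, AList.singleton, PosTerm.eval,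
        mkPTHere, PosTerm.hash, PosTerm.size]
    · simp [singletonVM, Expression.positions, AList.lookup, AList.singleton, h]
  · simp [singletonVM, Expression.positions, mapHash, entryTerm, entryHash, mkPTHere, PosTerm.hash]

theorem VarMap.Represents.remove {vm : VarMap b} {F : Finset Name} {V : Name → Option PosTerm}
    (h : vm.Represents f F V) (x : Name) :
    (removeFromVM f x vm).1.Represents f (F.erase x) (fun y => if y = x then none else V y) ∧
      (removeFromVM f x vm).2 = (V x).map (PosTerm.eval f) := by
  have hx := h.lookup x
  cases hV : V x with
  | none =>
    rw [hV, Option.map_none] at hx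
    have hxF : x ∉ F := by simp [h.mem, hV]
    have e : (fun y => if y = x then none else V y) = V := by
      funext y
      split_ifs with hy
      · rw [hy, hV]
      · rfl
    simp only [removeFromVM, hx, Finset.erase_eq_of_notMem hxF, e]
    exact ⟨h, rfl⟩
  | some p =>
    rw [hV, Option.map_some] at hx
    have hxF : x ∈ F := by simp [h.mem, hV]
    simp only [removeFromVM, hx]
    refine ⟨⟨fun y => ?_, fun y => ?_, ?_⟩, rfl⟩
    · by_cases hy : y = x
      · subst hy
        simp
      · simp [AList.lookup_erase_ne hy, hy, h.lookup]
    · by_cases hy : y = x <;> simp [hy, h.mem]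
    · rw [h.hash, mapHash_erase f hxF, mapHash_congr f (W := V)
        (fun y hy => if_neg (Finset.ne_of_mem_erase hy))]
      simp only [entryTerm, hV, Option.elim, entryHash, PosTerm.eval]
      rw [BitVec.xor_comm, ← BitVec.xor_assoc, BitVec.xor_self, BitVec.zero_xor]

/-- XOR with the old entry cancels it, so the incrementally updated code remains the XOR over the
current entries. -/
theorem VarMap.Represents.alter {vm : VarMap b} {F : Finset Name} {V : Name → Option PosTerm}
    (h : vm.Represents f F V) (x : Name) (g : Option (PosTree b) → PosTree b) (p : PosTerm)
    (hp : g ((V x).map (PosTerm.eval f)) = p.eval f) :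
    (alterVM f g x vm).Represents f (insert x F) (Function.update V x (some p)) := by
  have hx := h.lookup x
  have hentry : entryHash f x (p.eval f) = entryTerm f (Function.update V x (some p)) x := by
    simp [entryHash, entryTerm, PosTerm.eval]
  have herase (G : Finset Name) (hG : x ∉ G) :
      mapHash f G (Function.update V x (some p)) = mapHash f G V :=
    mapHash_congr f fun y hy => Function.update_of_ne (ne_of_mem_of_not_mem hy hG) _ _
  have hlook (y : Name) : (vm.entries.insert x (p.eval f)).lookup y =
      (Function.update V x (some p) y).map (PosTerm.eval f) := by
    by_cases hy : y = x
    · subst hy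
      simp
    · simp [AList.lookup_insert_ne hy, hy, h.lookup]
  have hmem (y : Name) : y ∈ insert x F ↔ Function.update V x (some p) y ≠ none := by
    by_cases hy : y = x
    · subst hy
      simp
    · simp [hy, h.mem]
  cases hV : V x with
  | none =>
    rw [hV, Option.map_none] at hx hp
    have hxF : x ∉ F := by simp [h.mem, hV]
    simp only [alterVM, hx, hp]
    refine ⟨hlook, hmem, ?_⟩
    rw [mapHash_insert f hxF, herase F hxF, h.hash, hentry, BitVec.xor_comm]
  | some q =>
    rw [hV, Option.map_some] at hx hp
    have hxF : x ∈ F := by simp [h.mem, hV]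
    simp only [alterVM, hx, hp]
    refine ⟨hlook, hmem, ?_⟩
    have hq : entryHash f x (q.eval f) = entryTerm f V x := by
      simp [entryHash, entryTerm, hV, PosTerm.eval]
    rw [Finset.insert_eq_of_mem hxF, mapHash_erase f hxF, herase _ (Finset.notMem_erase x F),
      h.hash, hentry, hq, mapHash_erase f hxF, BitVec.xor_comm (entryTerm f V x),
      BitVec.xor_assoc (mapHash f (F.erase x) V), BitVec.xor_self, BitVec.xor_zero, BitVec.xor_comm]

theorem eval_combine (t : ℕ) (q : Option PosTerm) (p : PosTerm) :
    ∃ r, PosTerm.combine t q (some p) = some r ∧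
      mkPTJoin f t (q.map (PosTerm.eval f)) (p.eval f) = r.eval f := by
  cases q with
  | none => exact ⟨_, rfl, by simp [mkPTJoin, PosTerm.eval, PosTerm.hash, PosTerm.size]⟩
  | some q => exact ⟨_, rfl, by simp [mkPTJoin, PosTerm.eval, PosTerm.hash, PosTerm.size]⟩

theorem VarMap.Represents.foldr {vm : VarMap b} {F : Finset Name} {V : Name → Option PosTerm}
    (h : vm.Represents f F V) (t : ℕ) (W : Name → Option PosTerm)
    (l : List (Sigma fun _ : Name => PosTree b)) (hl : l.NodupKeys)
    (hW : ∀ kv ∈ l, (W kv.1).map (PosTerm.eval f) = some kv.2) :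
    (l.foldr (fun kv vm => alterVM f (fun mp => mkPTJoin f t mp kv.2) kv.1 vm) vm).Represents f
      (F ∪ l.keys.toFinset)
      (fun y => if y ∈ l.keys then PosTerm.combine t (V y) (W y) else V y) := by
  induction l with
  | nil => simpa using h
  | cons kv l ih =>
    have hl' := List.nodupKeys_cons.1 hl
    have ih' := ih hl'.2 fun kv' h' => hW kv' (List.mem_cons_of_mem _ h')
    have hkv := hW kv List.mem_cons_self
    obtain ⟨p, hp, hpe⟩ := Option.map_eq_some_iff.1 hkv
    obtain ⟨r, hr, hre⟩ := eval_combine (f := f) t (V kv.1) p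
    -- Keys are distinct, so the value at `kv.1` is still the one from `V`.
    have := ih'.alter kv.1 (fun mp => mkPTJoin f t mp kv.2) r
      (by simp only [hl'.1, if_false, ← hpe]; exact hre)
    rw [List.foldr_cons]
    convert this using 1
    · ext y
      simp [List.keys_cons]
    · funext y
      by_cases hy : y = kv.1
      · subst hy
        simp [hp, hr]
      · simp [List.keys_cons, hy]

variable (f)

theorem represents_summariseExpr (e : Expression) :
    (summariseExpr f e).str = ⟨e.shape.hash f, e.size⟩ ∧
      (summariseExpr f e).vm.Represents f e.fv e.positions := by
  induction e with
  | var x => exact ⟨rfl, VarMap.represents_singleton x⟩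
  | lam x a ih =>
    obtain ⟨hs, hm⟩ := ih
    obtain ⟨h₁, h₂⟩ := hm.remove x
    refine ⟨?_, h₁⟩
    have e1 : PosTree.hash ∘ PosTerm.eval f = PosTerm.hash f := rfl
    simp only [summariseExpr, h₂, hs, mkSLam, Expression.shape, StrTerm.hash, Expression.size,
      Expression.size_shape, Option.map_map, e1]
  | app a c iha ihc =>
    obtain ⟨hsa, hma⟩ := iha
    obtain ⟨hsc, hmc⟩ := ihc
    refine ⟨?_, ?_⟩
    · simp only [summariseExpr, hsa, hsc, mkSApp, Expression.shape, StrTerm.hash, Expression.size,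
        Expression.size_shape, hma.sizeVM, hmc.sizeVM]
    -- Stated for arbitrary maps, since either side may be the bigger one. Names missing from the
    -- smaller map need no case of their own, as combining with `none` changes nothing.
    · have key {vm vm' : VarMap b} {F F' : Finset Name} {V V' : Name → Option PosTerm}
          (h : vm.Represents f F V) (h' : vm'.Represents f F' V') (t : ℕ) :
          (vm'.entries.entries.foldr
            (fun kv vm => alterVM f (fun mp => mkPTJoin f t mp kv.2) kv.1 vm) vm).Represents f
            (F ∪ F') (fun y => PosTerm.combine t (V y) (V' y)) := by
        have := h.foldr t V' vm'.entries.entries vm'.entries.nodupKeys (fun kv hkv => by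
          rw [← h'.lookup]
          exact AList.mem_lookup_iff.2 hkv)
        convert this using 1
        · rw [← h'.keys]
          rfl
        · funext y
          have hy : y ∈ vm'.entries.entries.keys ↔ V' y ≠ none := by
            rw [← h'.mem, ← h'.keys, List.mem_toFinset]
            rfl
          by_cases hn : V' y = none
          · rw [if_neg (by simp [hy, hn]), hn]
            rfl
          · rw [if_pos (hy.2 hn)]
      simp only [summariseExpr, hsa, hsc, mkSApp, structureTag, hma.sizeVM, hmc.sizeVM,
        Expression.fv]
      by_cases hlt : c.fv.card < a.fv.card
      · convert key hma hmc (a.size + c.size + 1) using 1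
        · simp [hlt]
        · funext y
          simp [Expression.positions, hlt]
      · convert key hmc hma (a.size + c.size + 1) using 1
        · simp [hlt]
        · exact Finset.union_comm _ _
        · funext y
          simp [Expression.positions, hlt]

/-- The hash code of an expression, computed from its symbolic summary; `N` may be any set that
contains the free variables. -/
theorem hashESummary_summariseExpr (e : Expression) {N : Finset Name} (hN : e.fv ⊆ N) :
    hashESummary f (summariseExpr f e) =
      f (.summary (e.shape.hash f) (mapHash f N e.positions)) := by
  obtain ⟨h₁, h₂⟩ := represents_summariseExpr f e
  rw [hashESummary, h₁, h₂.hash, mapHash_subset f hN fun y _ hy => by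
    simpa [Expression.mem_fv] using hy]

end Eval

/-! ### Collision probabilities -/

section Collision
variable {b : ℕ}

theorem card_hashCode (b : ℕ) : Nat.card (HashCode b) = 2 ^ b := by
  rw [Nat.card_congr (BitVec.equivFin (m := b)).toEquiv, Nat.card_fin]

theorem ofNat_injective {m n : ℕ} (hm : m < 2 ^ b) (hn : n < 2 ^ b)
    (h : BitVec.ofNat b m = BitVec.ofNat b n) : m = n := by
  have := congrArg BitVec.toNat h
  rwa [BitVec.toNat_ofNat, BitVec.toNat_ofNat, Nat.mod_eq_of_lt hm, Nat.mod_eq_of_lt hn] at this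

/-- The hash calls in which all names belong to `N`. -/
def callsOver (b : ℕ) (N : Finset Name) : Set (HashCall b) := {c | ∀ x, c = .name x → x ∈ N}

/-- Names are the only arguments that range over an infinite type. -/
theorem finite_callsOver (N : Finset Name) : (callsOver b N).Finite := by
  have h : callsOver b N ⊆ HashCall.name '' (N : Set Name) ∪ {.sVar, .ptHere} ∪
      Set.range (fun x : HashCode b × Option (HashCode b) × HashCode b =>
        .sLam x.1 x.2.1 x.2.2) ∪
      Set.range (fun x : HashCode b × Bool × HashCode b × HashCode b =>
        .sApp x.1 x.2.1 x.2.2.1 x.2.2.2) ∪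
      Set.range (fun x : HashCode b × HashCode b × Option (HashCode b) × HashCode b =>
        .ptJoin x.1 x.2.1 x.2.2.1 x.2.2.2) ∪
      Set.range (fun x : HashCode b × HashCode b => .entry x.1 x.2) ∪
      Set.range (fun x : HashCode b × HashCode b => .summary x.1 x.2) := by
    intro c hc
    cases c with
    | name x => simp [hc x rfl]
    | _ => simp
  refine Set.Finite.subset ?_ h
  exact ((((((N.finite_toSet.image _).union (Set.toFinite _)).union (Set.finite_range _)).union
    (Set.finite_range _)).union (Set.finite_range _)).union (Set.finite_range _)).union
    (Set.finite_range _)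

variable {N : Finset Name}

local notation "ε" => (Nat.card (HashCode b) : ℝ)⁻¹

theorem inv_card_nonneg : 0 ≤ ε := by positivity

/-! ### Stability of hash codes under resampling one value -/

section
variable {f : HashFun b} {c : HashCall b} (v : HashCode b)

open Classical in
theorem PosTerm.hash_update {p : PosTerm} (hc : ∀ q : PosTerm, q.size ≤ p.size → q.call f ≠ c) :
    p.hash (Function.update f c v) = p.hash f := by
  induction p with
  | here => exact Function.update_of_ne (hc here le_rfl) _ _
  | extend t p ih =>
    have hp := ih fun q hq => hc q (hq.trans (by simp only [size]; omega))
    simp only [hash, hp]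
    exact Function.update_of_ne (hc (extend t p) le_rfl) _ _
  | join t q p ihq ihp =>
    have hq := ihq fun r hr => hc r (hr.trans (by simp only [size]; omega))
    have hp := ihp fun r hr => hc r (hr.trans (by simp only [size]; omega))
    simp only [hash, hp, hq]
    exact Function.update_of_ne (hc (join t q p) le_rfl) _ _

-- The arguments of the last call are hash codes of proper subtrees, so strictly smaller sizes
-- suffice here.
open Classical in
theorem PosTerm.call_update {p : PosTerm} (hc : ∀ q : PosTerm, q.size < p.size → q.call f ≠ c) :
    p.call (Function.update f c v) = p.call f := by
  cases p with
  | here => rfl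
  | extend t p =>
    have hp := hash_update v (p := p) fun q hq => hc q (by simp only [size]; omega)
    simp only [call, hp]
  | join t q p =>
    have hp := hash_update v (p := p) fun q hq => hc q (by simp only [size]; omega)
    have hq := hash_update v (p := q) fun q hq => hc q (by simp only [size]; omega)
    simp only [call, hp, hq]

open Classical in
theorem StrTerm.hash_update {s : StrTerm} (hp : ∀ q : PosTerm, q.call f ≠ c)
    (hc : ∀ s' : StrTerm, s'.size ≤ s.size → s'.call f ≠ c) :
    s.hash (Function.update f c v) = s.hash f := by
  have hp' : PosTerm.hash (Function.update f c v) = PosTerm.hash f :=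
    funext fun p => PosTerm.hash_update v fun q _ => hp q
  induction s with
  | var => exact Function.update_of_ne (hc var le_rfl) _ _
  | lam p s ih =>
    have hs := ih fun q hq => hc q (hq.trans (by simp only [size]; omega))
    simp only [hash, hs, hp']
    exact Function.update_of_ne (hc (lam p s) le_rfl) _ _
  | app β s₁ s₂ ih₁ ih₂ =>
    have h₁ := ih₁ fun r hr => hc r (hr.trans (by simp only [size]; omega))
    have h₂ := ih₂ fun r hr => hc r (hr.trans (by simp only [size]; omega))
    simp only [hash, h₁, h₂]
    exact Function.update_of_ne (hc (app β s₁ s₂) le_rfl) _ _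

open Classical in
theorem StrTerm.call_update {s : StrTerm} (hp : ∀ q : PosTerm, q.call f ≠ c)
    (hc : ∀ s' : StrTerm, s'.size < s.size → s'.call f ≠ c) :
    s.call (Function.update f c v) = s.call f := by
  have hp' : PosTerm.hash (Function.update f c v) = PosTerm.hash f :=
    funext fun p => PosTerm.hash_update v fun q _ => hp q
  cases s with
  | var => rfl
  | lam p s =>
    have hs := hash_update v (s := s) hp fun q hq => hc q (by simp only [size]; omega)
    simp only [call, hs, hp']
  | app β s₁ s₂ =>
    have h₁ := hash_update v (s := s₁) hp fun q hq => hc q (by simp only [size]; omega)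
    have h₂ := hash_update v (s := s₂) hp fun q hq => hc q (by simp only [size]; omega)
    simp only [call, h₁, h₂]

/-- The salt is an argument of the call and determines any size below 2^b; the unsalted `here`
always has size 1. -/
theorem PosTerm.size_eq_of_call_eq {p q : PosTerm} (h : p.call f = q.call f)
    (hp : p.size < 2 ^ b) (hq : q.size < 2 ^ b) : p.size = q.size := by
  cases p <;> cases q <;> simp only [call, HashCall.ptJoin.injEq, reduceCtorEq] at h <;>
    first | rfl | exact ofNat_injective hp hq h.1

theorem StrTerm.size_eq_of_call_eq {p q : StrTerm} (h : p.call f = q.call f)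
    (hp : p.size < 2 ^ b) (hq : q.size < 2 ^ b) : p.size = q.size := by
  cases p <;> cases q <;>
    simp only [call, HashCall.sLam.injEq, HashCall.sApp.injEq, reduceCtorEq] at h <;>
    first | rfl | exact ofNat_injective hp hq h.1

theorem PosTerm.call_ne_call (p : PosTerm) (s : StrTerm) : p.call f ≠ s.call f := by
  cases p <;> cases s <;> simp [call, StrTerm.call]

theorem PosTerm.call_mem (p : PosTerm) : p.call f ∈ callsOver b N := by
  cases p <;> simp [call, callsOver]

theorem StrTerm.call_mem (s : StrTerm) : s.call f ∈ callsOver b N := by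
  cases s <;> simp [call, callsOver]

end

/-- Let p be the larger tree. By the salt, no tree smaller than p has the call of p, so resampling
the value there leaves the arguments of both last calls unchanged. -/
theorem PosTerm.prob_collision_of_call_ne {p q : PosTerm} (hp : p.size < 2 ^ b)
    (hq : q.size < 2 ^ b) :
    prob (callsOver b N) {f | p.call f ≠ q.call f ∧ p.hash f = q.hash f} ≤ ε := by
  wlog hpq : q.size ≤ p.size generalizing p q
  · have := this hq hp (le_of_not_ge hpq)
    simpa only [eq_comm, ne_comm] using this
  simp only [hash_eq]
  have h (f : HashFun b) (r : PosTerm) (hr : r.size < p.size) : r.call f ≠ p.call f := fun e =>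
    hr.ne (size_eq_of_call_eq e (hr.trans hp) hp)
  exact prob_collision_le (finite_callsOver N) (fun f => p.call f) (fun f => q.call f)
    (fun f => p.call_mem) (fun f v => call_update v (h f))
    (fun f v => call_update v fun r hr => h f r (hr.trans_le hpq))

theorem StrTerm.prob_collision_of_call_ne {p q : StrTerm} (hp : p.size < 2 ^ b)
    (hq : q.size < 2 ^ b) :
    prob (callsOver b N) {f | p.call f ≠ q.call f ∧ p.hash f = q.hash f} ≤ ε := by
  wlog hpq : q.size ≤ p.size generalizing p q
  · have := this hq hp (le_of_not_ge hpq)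
    simpa only [eq_comm, ne_comm] using this
  simp only [hash_eq]
  have h (f : HashFun b) (r : StrTerm) (hr : r.size < p.size) : r.call f ≠ p.call f := fun e =>
    hr.ne (size_eq_of_call_eq e (hr.trans hp) hp)
  exact prob_collision_le (finite_callsOver N) (fun f => p.call f) (fun f => q.call f)
    (fun f => p.call_mem) (fun f v => call_update v (fun r => r.call_ne_call p) (h f))
    (fun f v => call_update v (fun r => r.call_ne_call p) fun r hr => h f r (hr.trans_le hpq))

/-- A collision of hash codes is a collision of the last hash calls or of their arguments. -/
theorem prob_hash_le_add {h h' : HashFun b → HashCode b} {a a' : HashFun b → HashCall b}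
    (F : Set (HashFun b)) {n : ℕ} (h₁ : prob (callsOver b N) {f | a f ≠ a' f ∧ h f = h' f} ≤ ε)
    (hF : {f | a f = a' f} ⊆ F) (h₂ : prob (callsOver b N) F ≤ n * ε) :
    prob (callsOver b N) {f | h f = h' f} ≤ ((n + 1 : ℕ) : ℝ) * ε := by
  have h₃ := prob_le_add (E := {f | h f = h' f}) (finite_callsOver N) (fun f hf => by
    by_cases e : a f = a' f
    · exact Or.inr (hF e)
    · exact Or.inl ⟨e, hf⟩) h₁ h₂
  push_cast
  linarith

theorem prob_empty_le (n : ℕ) : prob (callsOver b N) (∅ : Set (HashFun b)) ≤ n * ε := by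
  rw [prob_empty]
  positivity

theorem prob_le_of_le {E : Set (HashFun b)} {m n : ℕ} (h : prob (callsOver b N) E ≤ m * ε)
    (hmn : m ≤ n) : prob (callsOver b N) E ≤ n * ε :=
  h.trans (by gcongr)

/-- Equal calls force all components to collide, so the union bound only follows one pair of
differing components per level. If only the tags differ, the calls differ, as tags are below 2^b. -/
theorem PosTerm.prob_collision {m : ℕ} (hm : m < 2 ^ b) {p q : PosTerm} (hpq : p ≠ q)
    (hp : p.size ≤ m) (hq : q.size ≤ m) (hp' : p.TagsLE m) (hq' : q.TagsLE m) :
    prob (callsOver b N) {f | p.hash f = q.hash f} ≤ p.size * ε := by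
  induction p generalizing q with
  | here =>
    refine prob_hash_le_add ∅ (prob_collision_of_call_ne (hp.trans_lt hm) (hq.trans_lt hm))
      (fun f hf => ?_) (prob_empty_le 0)
    cases q <;> simp_all [call]
  | extend t p ih =>
    have hc := prob_collision_of_call_ne (N := N) (hp.trans_lt hm) (hq.trans_lt hm)
    cases q with
    | here => exact prob_hash_le_add ∅ hc (fun f hf => by simp [call] at hf) (prob_empty_le _)
    | join t' q' p' =>
      exact prob_hash_le_add ∅ hc (fun f hf => by simp [call] at hf) (prob_empty_le _)
    | extend t' p' =>
      simp only [size] at hp hq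
      by_cases hpp : p = p'
      · refine prob_hash_le_add ∅ hc (fun f hf => ?_) (prob_empty_le _)
        simp only [call, Set.mem_ofPred_eq, HashCall.ptJoin.injEq] at hf
        exact hpq (by rw [hpp, ofNat_injective (hp'.1.trans_lt hm) (hq'.1.trans_lt hm) hf.2.1])
      · refine prob_hash_le_add _ hc (fun f hf => ?_)
          (ih hpp (by omega) (by omega) hp'.2 hq'.2)
        simp only [call, Set.mem_ofPred_eq, HashCall.ptJoin.injEq] at hf
        exact hf.2.2.2
  | join t r p ihr ihp =>
    have hc := prob_collision_of_call_ne (N := N) (hp.trans_lt hm) (hq.trans_lt hm)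
    cases q with
    | here => exact prob_hash_le_add ∅ hc (fun f hf => by simp [call] at hf) (prob_empty_le _)
    | extend t' p' =>
      exact prob_hash_le_add ∅ hc (fun f hf => by simp [call] at hf) (prob_empty_le _)
    | join t' r' p' =>
      simp only [size] at hp hq
      by_cases hpp : p = p'
      · by_cases hrr : r = r'
        · refine prob_hash_le_add ∅ hc (fun f hf => ?_) (prob_empty_le _)
          simp only [call, Set.mem_ofPred_eq, HashCall.ptJoin.injEq] at hf
          exact hpq (by
            rw [hpp, hrr, ofNat_injective (hp'.1.trans_lt hm) (hq'.1.trans_lt hm) hf.2.1])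
        · refine prob_hash_le_add _ hc (fun f hf => ?_)
            (prob_le_of_le (ihr hrr (by omega) (by omega) hp'.2.1 hq'.2.1) (by omega))
          simp only [call, Set.mem_ofPred_eq, HashCall.ptJoin.injEq, Option.some.injEq] at hf
          exact hf.2.2.1
      · refine prob_hash_le_add _ hc (fun f hf => ?_)
          (prob_le_of_le (ihp hpp (by omega) (by omega) hp'.2.2 hq'.2.2) (by omega))
        simp only [call, Set.mem_ofPred_eq, HashCall.ptJoin.injEq] at hf
        exact hf.2.2.2

theorem PosTerm.prob_collision_option {m : ℕ} (hm : m < 2 ^ b) {p q : Option PosTerm}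
    (hpq : p ≠ q) (hp : ∀ r ∈ p, r.size ≤ m ∧ r.TagsLE m) (hq : ∀ r ∈ q, r.size ≤ m ∧ r.TagsLE m) :
    prob (callsOver b N) {f | p.map (PosTerm.hash f) = q.map (PosTerm.hash f)} ≤ m * ε := by
  cases p with
  | none =>
    cases q with
    | none => exact absurd rfl hpq
    | some q => simpa using prob_empty_le (N := N) (b := b) m
  | some p =>
    cases q with
    | none => simpa using prob_empty_le (N := N) (b := b) m
    | some q =>
      have h₁ := hp p rfl
      have h₂ := hq q rfl
      have := prob_collision (N := N) hm (fun e => hpq (by rw [e])) h₁.1 h₂.1 h₁.2 h₂.2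
      simpa using prob_le_of_le this h₁.1

theorem StrTerm.prob_collision {p q : StrTerm} (hpq : p ≠ q) (hp : p.size < 2 ^ b)
    (hq : q.size < 2 ^ b) (hp' : p.WellSized) (hq' : q.WellSized) :
    prob (callsOver b N) {f | p.hash f = q.hash f} ≤ p.size * ε := by
  have hc := prob_collision_of_call_ne (N := N) hp hq
  induction p generalizing q with
  | var =>
    refine prob_hash_le_add ∅ hc (fun f hf => ?_) (prob_empty_le 0)
    cases q <;> simp_all [call]
  | lam p s ih =>
    cases q with
    | var => exact prob_hash_le_add ∅ hc (fun f hf => by simp [call] at hf) (prob_empty_le _)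
    | app β s₁ s₂ =>
      exact prob_hash_le_add ∅ hc (fun f hf => by simp [call] at hf) (prob_empty_le _)
    | lam p' s' =>
      -- Bodies of different sizes give different salts. For equal sizes, `WellSized` bounds the
      -- position trees on both sides by `s.size`, so a collision there costs no more than one of
      -- the bodies.
      by_cases hn : s.size = s'.size
      · simp only [size] at hp hq
        by_cases hs : s = s'
        · have hpp : p ≠ p' := fun e => hpq (by rw [hs, e])
          have := hq'.1
          rw [← hn] at this
          refine prob_hash_le_add _ hc (fun f hf => ?_)
            (PosTerm.prob_collision_option (by omega) hpp hp'.1 this)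
          simp only [call, Set.mem_ofPred_eq, HashCall.sLam.injEq] at hf
          exact hf.2.1
        · refine prob_hash_le_add _ hc (fun f hf => ?_)
            (ih hs (by omega) (by omega) hp'.2 hq'.2
              (prob_collision_of_call_ne (by omega) (by omega)))
          simp only [call, Set.mem_ofPred_eq, HashCall.sLam.injEq] at hf
          exact hf.2.2
      · refine prob_hash_le_add ∅ hc (fun f hf => hn ?_) (prob_empty_le _)
        have := size_eq_of_call_eq hf hp hq
        simpa [size] using this
  | app β s₁ s₂ ih₁ ih₂ =>
    cases q with
    | var => exact prob_hash_le_add ∅ hc (fun f hf => by simp [call] at hf) (prob_empty_le _)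
    | lam p s =>
      exact prob_hash_le_add ∅ hc (fun f hf => by simp [call] at hf) (prob_empty_le _)
    | app β' s₁' s₂' =>
      simp only [size] at hp hq
      by_cases h₁ : s₁ = s₁'
      · by_cases h₂ : s₂ = s₂'
        · refine prob_hash_le_add ∅ hc (fun f hf => ?_) (prob_empty_le _)
          simp only [call, Set.mem_ofPred_eq, HashCall.sApp.injEq] at hf
          exact hpq (by rw [h₁, h₂, hf.2.1])
        · refine prob_hash_le_add _ hc (fun f hf => ?_)
            (prob_le_of_le (ih₂ h₂ (by omega) (by omega) hp'.2 hq'.2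
              (prob_collision_of_call_ne (by omega) (by omega))) (by omega))
          simp only [call, Set.mem_ofPred_eq, HashCall.sApp.injEq] at hf
          exact hf.2.2.2
      · refine prob_hash_le_add _ hc (fun f hf => ?_)
          (prob_le_of_le (ih₁ h₁ (by omega) (by omega) hp'.1 hq'.1
            (prob_collision_of_call_ne (by omega) (by omega))) (by omega))
        simp only [call, Set.mem_ofPred_eq, HashCall.sApp.injEq] at hf
        exact hf.2.2.1

/-! ### Collisions of variable maps and of summaries -/

theorem prob_name_collision {x y : Name} (hx : x ∈ N) (hxy : x ≠ y) :
    prob (callsOver b N) {f : HashFun b | f (.name x) = f (.name y)} ≤ ε := by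
  have hne : HashCall.name (b := b) x ≠ .name y := by simpa using hxy
  have := prob_collision_le (B := HashCode b) (finite_callsOver (b := b) N) (fun _ => .name x)
    (fun _ => .name y) (fun _ => by simp [callsOver, hx]) (fun _ _ => rfl) (fun _ _ => rfl)
  simpa [hne, hxy] using this

section
variable {f : HashFun b} (v : HashCode b)

open Classical in
theorem entryTerm_update {x y : Name} {p : PosTerm} {V : Name → Option PosTerm}
    (h : ∀ q ∈ V y, f (.name y) ≠ f (.name x) ∨ q.hash f ≠ p.hash f) :
    entryTerm (Function.update f (.entry (f (.name x)) (p.hash f)) v) V y = entryTerm f V y := by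
  unfold entryTerm
  cases hV : V y with
  | none => rfl
  | some q =>
    have hq := PosTerm.hash_update (f := f) (c := .entry (f (.name x)) (p.hash f)) v (p := q)
      (fun r _ => by cases r <;> simp [PosTerm.call])
    have hne : HashCall.entry (f (.name y)) (q.hash f) ≠ .entry (f (.name x)) (p.hash f) := by
      rcases h q hV with h | h <;> simp [h]
    simp only [Option.elim]
    rw [hq, Function.update_of_ne (a := HashCall.name y) (by simp), Function.update_of_ne hne]

end

-- The three terms of the bound are: another name with the hash of x, a tree at x in `W` with the
-- hash of p, and, failing both, an accidental value of the entry call for (x, p), which then occurs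
-- only once in the two XORs. Trees at other names need no bound.
open Classical in
theorem prob_mapHash_collision_aux {m : ℕ} (hm : m < 2 ^ b) {V W : Name → Option PosTerm} {x : Name}
    (hx : x ∈ N) {p : PosTerm} (hV : V x = some p) (hW : W x ≠ some p)
    (hp : p.size ≤ m ∧ p.TagsLE m) (hW' : ∀ q ∈ W x, q.size ≤ m ∧ q.TagsLE m) :
    prob (callsOver b N) {f | mapHash f N V = mapHash f N W} ≤ (N.card + m + 1 : ℕ) * ε := by
  have hS := finite_callsOver (b := b) N
  have h₁ : prob (callsOver b N) (⋃ y ∈ N.erase x, {f : HashFun b | f (.name y) = f (.name x)}) ≤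
      N.card * ε := by
    refine (prob_biUnion_le _ _ _).trans ((Finset.sum_le_card_nsmul _ _ ε fun y hy => ?_).trans ?_)
    · rw [Finset.mem_erase] at hy
      exact prob_name_collision hy.2 hy.1
    · rw [nsmul_eq_mul]
      gcongr
      exact Finset.erase_subset _ _
  have h₂ : prob (callsOver b N)
      {f | (some p).map (PosTerm.hash f) = (W x).map (PosTerm.hash f)} ≤ m * ε :=
    PosTerm.prob_collision_option hm hW.symm (by simpa using hp) hW'
  have h₃ : prob (callsOver b N) {f | (∀ y ∈ N, y ≠ x → f (.name y) ≠ f (.name x)) ∧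
      (∀ q ∈ W x, q.hash f ≠ p.hash f) ∧ mapHash f N V = mapHash f N W} ≤ ε := by
    -- The equation of the two XORs is solved for the entry of x. The solution is stable under
    -- resampling only on this event, which is why stability is required only there.
    refine prob_le_of_update hS _ (fun f => .entry (f (.name x)) (p.hash f))
      (fun f => mapHash f N W ^^^ mapHash f (N.erase x) V) (fun f _ => by simp [callsOver])
      (fun f hf => ?_) (fun f hf v => ?_) (fun f hf v => ?_)
    · rw [← hf.2.2, mapHash_erase f hx, entryTerm, hV, Option.elim, BitVec.xor_assoc,
        BitVec.xor_self, BitVec.xor_zero]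
    · rw [Function.update_of_ne (by simp),
        PosTerm.hash_update v (fun r _ => by cases r <;> simp [PosTerm.call])]
    · have e₁ : mapHash (Function.update f (.entry (f (.name x)) (p.hash f)) v) N W =
          mapHash f N W := by
        refine Finset.fold_congr fun y hy => entryTerm_update v fun q hq => ?_
        by_cases hyx : y = x
        · subst hyx
          exact Or.inr (hf.2.1 q hq)
        · exact Or.inl (hf.1 y hy hyx)
      have e₂ : mapHash (Function.update f (.entry (f (.name x)) (p.hash f)) v) (N.erase x) V =
          mapHash f (N.erase x) V := by
        refine Finset.fold_congr fun y hy => entryTerm_update v fun q hq => Or.inl ?_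
        rw [Finset.mem_erase] at hy
        exact hf.1 y hy.2 hy.1
      simp only [e₁, e₂]
  have h₄ := prob_le_add hS Set.Subset.rfl h₁ h₂
  have h₅ := prob_le_add (E := {f | mapHash f N V = mapHash f N W}) hS (fun f hf => ?_) h₄ h₃
  · push_cast
    linarith
  · by_cases hn : ∃ y ∈ N, y ≠ x ∧ f (.name y) = f (.name x)
    · obtain ⟨y, hy, hyx, e⟩ := hn
      refine Or.inl (Or.inl ?_)
      simp only [Set.mem_iUnion]
      exact ⟨y, Finset.mem_erase.2 ⟨hyx, hy⟩, e⟩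
    · by_cases hq : ∃ q ∈ W x, q.hash f = p.hash f
      · obtain ⟨q, hq, e⟩ := hq
        refine Or.inl (Or.inr ?_)
        rw [Option.mem_def] at hq
        simp [hq, e]
      · push Not at hn hq
        exact Or.inr ⟨hn, hq, hf⟩

theorem prob_mapHash_collision {m : ℕ} (hm : m < 2 ^ b) {V W : Name → Option PosTerm} {x : Name}
    (hx : x ∈ N) (hne : V x ≠ W x) (hV : ∀ q ∈ V x, q.size ≤ m ∧ q.TagsLE m)
    (hW : ∀ q ∈ W x, q.size ≤ m ∧ q.TagsLE m) :
    prob (callsOver b N) {f | mapHash f N V = mapHash f N W} ≤ (N.card + m + 1 : ℕ) * ε := by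
  cases hp : V x with
  | some p => exact prob_mapHash_collision_aux hm hx hp (hp ▸ hne.symm) (hV p hp) hW
  | none =>
    cases hq : W x with
    | none => exact absurd (hp.trans hq.symm) hne
    | some q =>
      simpa only [eq_comm] using prob_mapHash_collision_aux hm hx hq (hq ▸ hne) (hW q hq) hV

-- No salt is needed: the value of a summary call is never an argument of another call.
open Classical in
theorem prob_summary_collision {s s' : StrTerm} {V V' : Name → Option PosTerm} :
    prob (callsOver b N)
      {f | HashCall.summary (s.hash f) (mapHash f N V) ≠ .summary (s'.hash f) (mapHash f N V') ∧
        f (.summary (s.hash f) (mapHash f N V)) = f (.summary (s'.hash f) (mapHash f N V'))} ≤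
      ε := by
  have hp {f : HashFun b} (r : PosTerm) (x y : HashCode b) : r.call f ≠ .summary x y := by
    cases r <;> simp [PosTerm.call]
  have hs {f : HashFun b} (r : StrTerm) (x y : HashCode b) : r.call f ≠ .summary x y := by
    cases r <;> simp [StrTerm.call]
  have hm {f : HashFun b} (x y v : HashCode b) (V : Name → Option PosTerm) :
      mapHash (Function.update f (.summary x y) v) N V = mapHash f N V := by
    refine Finset.fold_congr fun z hz => ?_
    unfold entryTerm
    cases V z with
    | none => rfl
    | some q =>
      simp only [Option.elim]
      rw [PosTerm.hash_update v fun r _ => hp r x y, Function.update_of_ne (by simp),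
        Function.update_of_ne (by simp)]
  have hs' {f : HashFun b} (x y v : HashCode b) (r : StrTerm) :
      r.hash (Function.update f (.summary x y) v) = r.hash f :=
    StrTerm.hash_update v (fun r => hp r x y) fun r _ => hs r x y
  exact prob_collision_le (finite_callsOver N) _ _ (fun f => by simp [callsOver])
    (fun f v => by simp only [hm, hs']) (fun f v => by simp only [hm, hs'])

/-- The hash codes of expressions that are not alpha-equivalent rarely collide. -/
theorem prob_hashESummary_collision {n : ℕ} (hn : n < 2 ^ b) (hN : N.card ≤ n) {a c : Expression}
    (ha : a.size ≤ n) (hc : c.size ≤ n) (haN : a.fv ⊆ N) (hcN : c.fv ⊆ N) (h : ¬ a.AlphaEq c) :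
    prob (callsOver b N)
      {f | hashESummary f (summariseExpr f a) = hashESummary f (summariseExpr f c)} ≤
      (2 * n + 2 : ℕ) * ε := by
  simp only [hashESummary_summariseExpr _ a haN, hashESummary_summariseExpr _ c hcN]
  rw [Expression.alphaEq_iff] at h
  -- Equal shapes leave a variable with different positions, and the maps collide with probability
  -- at most (n + n + 1)ε; different shapes collide with probability at most nε. The top-level
  -- combiner adds ε.
  by_cases hs : a.shape = c.shape
  · have hp : a.positions ≠ c.positions := fun e => h ⟨hs, e⟩
    obtain ⟨x, hx⟩ := Function.ne_iff.1 hp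
    have hxN : x ∈ N := by
      by_cases hxa : x ∈ a.fv
      · exact haN hxa
      · refine hcN ((c.mem_fv x).2 fun e => hx ?_)
        rw [e]
        simpa [Expression.mem_fv] using hxa
    have bound (e : Expression) (he : e.size ≤ n) : ∀ q ∈ e.positions x, q.size ≤ n ∧ q.TagsLE n :=
      fun q hq => ⟨(e.size_positions_le x q hq).trans he, (e.tagsLE_positions x q hq).mono he⟩
    refine prob_hash_le_add _ prob_summary_collision (fun f hf => ?_)
      (prob_le_of_le (prob_mapHash_collision hn hxN hx (bound a ha) (bound c hc)) (by omega))
    simp only [Set.mem_ofPred_eq, HashCall.summary.injEq] at hf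
    exact hf.2
  · refine prob_hash_le_add _ prob_summary_collision (fun f hf => ?_)
      (prob_le_of_le (StrTerm.prob_collision hs ?_ ?_ a.wellSized_shape c.wellSized_shape) ?_)
    · simp only [Set.mem_ofPred_eq, HashCall.summary.injEq] at hf
      exact hf.1
    all_goals
      simp only [Expression.size_shape]
      omega

/-! ### From collisions to classes -/

theorem hashESummary_congr {f g : HashFun b} (hfg : ∀ c ∈ callsOver b N, g c = f c)
    (a : Expression) (haN : a.fv ⊆ N) :
    hashESummary g (summariseExpr g a) = hashESummary f (summariseExpr f a) := by
  have hp : PosTerm.hash g = PosTerm.hash f := by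
    funext p
    induction p <;> simp_all [PosTerm.hash, callsOver]
  have hs : StrTerm.hash g = StrTerm.hash f := by
    funext s
    induction s <;> simp_all [StrTerm.hash, callsOver]
  have hm : mapHash g N a.positions = mapHash f N a.positions := by
    refine Finset.fold_congr fun y hy => ?_
    unfold entryTerm
    rw [hp, hfg (.name y) (by simp [callsOver, hy])]
    congr
    funext p
    exact hfg _ (by simp [callsOver])
  rw [hashESummary_summariseExpr g a haN, hashESummary_summariseExpr f a haN, hs, hm,
    hfg _ (by simp [callsOver])]

theorem hashESummary_eq_of_alphaEq (f : HashFun b) {a c : Expression} (h : a.AlphaEq c) :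
    hashESummary f (summariseExpr f a) = hashESummary f (summariseExpr f c) := by
  rw [Expression.alphaEq_iff] at h
  rw [hashESummary_summariseExpr f a Finset.subset_union_left,
    hashESummary_summariseExpr f c Finset.subset_union_right, h.1, h.2]

/-- Alpha-equivalent nodes share a hash code for every `f`, so only false identifications have to be
excluded. -/
theorem recoveredClasses_eq {f : HashFun b} {e : Expression}
    (h : ∀ i j : e.Node, hashESummary f (summariseExpr f (e.at_ i)) =
      hashESummary f (summariseExpr f (e.at_ j)) → (e.at_ i).AlphaEq (e.at_ j)) :
    recoveredClasses f e = alphaClasses e := by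
  unfold recoveredClasses alphaClasses
  congr 1
  funext i
  ext j
  exact ⟨h i j, hashESummary_eq_of_alphaEq f⟩

theorem IsRandomFunction.measure_recoveredClasses {P : Measure (HashFun b)}
    (hP : IsRandomFunction P) (e : Expression) :
    1 - 5 * (e.size : ℝ) ^ 3 * ε ≤ P.real {f | recoveredClasses f e = alphaClasses e} := by
  classical
  have hP1 : IsProbabilityMeasure P := hP.2.isProbabilityMeasure
  have hpos : (1 : ℝ) ≤ e.size := by exact_mod_cast e.size_pos
  have hcard : (0 : ℝ) < Nat.card (HashCode b) := by
    rw [card_hashCode]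
    positivity
  -- Salts and tags are faithful only below 2^b. Otherwise |e|ε ≥ 1 and the claimed lower bound is
  -- at most 0.
  by_cases hn : e.size < 2 ^ b
  swap
  · have h₁ : (Nat.card (HashCode b) : ℝ) ≤ e.size := by
      rw [card_hashCode]
      exact_mod_cast not_lt.1 hn
    have h₂ : 1 ≤ (e.size : ℝ) * ε := by
      rw [← div_eq_mul_inv, one_le_div hcard]
      exact h₁
    have h₃ : (e.size : ℝ) ≤ 5 * (e.size : ℝ) ^ 3 := by nlinarith [sq_nonneg (e.size : ℝ)]
    have h₄ : (e.size : ℝ) * ε ≤ 5 * (e.size : ℝ) ^ 3 * ε := by gcongr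
    linarith [measureReal_nonneg (μ := P) (s := {f | recoveredClasses f e = alphaClasses e})]
  set N := e.vars
  let bad (ij : e.Node × e.Node) : Set (HashFun b) :=
    {f | hashESummary f (summariseExpr f (e.at_ ij.1)) =
      hashESummary f (summariseExpr f (e.at_ ij.2))}
  let t : Finset (e.Node × e.Node) :=
    Finset.univ.filter fun ij => ¬ (e.at_ ij.1).AlphaEq (e.at_ ij.2)
  have hmem (i : e.Node) : e.at_ i ∈ e.subexprs := List.get_mem _ _
  have hfv (i : e.Node) : (e.at_ i).fv ⊆ N :=
    (e.at_ i).fv_subset_vars.trans (Expression.vars_subset_of_mem_subexprs (hmem i))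
  have hsize (i : e.Node) : (e.at_ i).size ≤ e.size := Expression.size_le_of_mem_subexprs (hmem i)
  have hbad : P.real (⋃ ij ∈ t, bad ij) ≤ 5 * (e.size : ℝ) ^ 3 * ε := by
    calc P.real (⋃ ij ∈ t, bad ij) ≤ prob (callsOver b N) (⋃ ij ∈ t, bad ij) := by
          refine hP.measure_le_prob (finite_callsOver N) fun f hf g hg => ?_
          simp only [Set.mem_iUnion] at hf ⊢
          obtain ⟨ij, hij, hf⟩ := hf
          refine ⟨ij, hij, ?_⟩
          simp only [bad, Set.mem_ofPred_eq] at hf ⊢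
          rwa [hashESummary_congr hg _ (hfv _), hashESummary_congr hg _ (hfv _)]
      _ ≤ ∑ ij ∈ t, prob (callsOver b N) (bad ij) := prob_biUnion_le _ _ _
      _ ≤ t.card • ((2 * e.size + 2 : ℕ) * ε) := Finset.sum_le_card_nsmul _ _ _ fun ij hij =>
          prob_hashESummary_collision hn e.card_vars_le (hsize _) (hsize _) (hfv _) (hfv _)
            (Finset.mem_filter.1 hij).2
      _ ≤ (e.size ^ 2 : ℕ) * ((2 * e.size + 2 : ℕ) * ε) := by
          rw [nsmul_eq_mul]
          gcongr
          refine (Finset.card_le_univ t).trans_eq ?_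
          rw [Fintype.card_prod, Fintype.card_fin, e.length_subexprs, sq]
      -- For n ≥ 1, n²(2n + 2) ≤ 4n³, so the constant 5 leaves room.
      _ ≤ 5 * (e.size : ℝ) ^ 3 * ε := by
          rw [← mul_assoc]
          refine mul_le_mul_of_nonneg_right ?_ inv_card_nonneg
          push_cast
          nlinarith [mul_le_mul_of_nonneg_left hpos (sq_nonneg (e.size : ℝ))]
  -- Subadditivity on a cover of the whole space replaces taking complements, so no event has to be
  -- shown measurable.
  have hcover : (Set.univ : Set (HashFun b)) ⊆
      {f | recoveredClasses f e = alphaClasses e} ∪ ⋃ ij ∈ t, bad ij := by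
    intro f _
    by_cases hf : f ∈ ⋃ ij ∈ t, bad ij
    · exact Or.inr hf
    · refine Or.inl (recoveredClasses_eq fun i j hij => ?_)
      by_contra hα
      refine hf ?_
      simp only [Set.mem_iUnion]
      exact ⟨(i, j), by simpa [t] using hα, hij⟩
  have h₁ := measureReal_mono (μ := P) hcover (measure_ne_top P _)
  have h₂ := measureReal_union_le (μ := P) {f | recoveredClasses f e = alphaClasses e}
    (⋃ ij ∈ t, bad ij)
  rw [probReal_univ] at h₁
  linarith

end Collision

end AlphaHash

theorem mainTheorem2 (b : ℕ) (hb : 0 < b) :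
    ∃ P : MeasureTheory.Measure (AlphaHash.HashFun b),
      MeasureTheory.IsProbabilityMeasure P ∧ AlphaHash.IsRandomFunction P ∧
      ∀ e : AlphaHash.Expression,
        1 - 5 * (e.size : ℝ) ^ 3 * (2 : ℝ) ^ (-(b : ℤ)) ≤
          P.real {f | AlphaHash.recoveredClasses f e = AlphaHash.alphaClasses e} := by
  obtain ⟨P, h₁, h₂⟩ :=
    AlphaHash.exists_isRandomFunction (AlphaHash.HashCall b) (AlphaHash.HashCode b)
  refine ⟨P, h₁, h₂, fun e => ?_⟩
  have := h₂.measure_recoveredClasses e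
  rw [AlphaHash.card_hashCode] at this
  simpa [zpow_neg] using this
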